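/- Let $k\ge 1$, let $K_k$ be the complete graph with vertex set $\{v_1,\dots,v_k\}$, and let $\omega$ be a real-valued weight function on its edge set. Let $\tau(K_k,\omega)=\sum_{T}\prod_{e\in E(T)}\omega(e)$, where $T$ runs over all spanning trees of $K_k$ (an empty product is $1$). In the $2k$ variables $x_1,\dots,x_k,y_1,\dots,y_k$ consider, with $X=x_1+\dots+x_k$ and $Y=y_1+\dots+y_k$, the rational function $$\phi(x_1,y_1,\dots,x_k,y_k)=\frac{1}{XY}\left(\prod_{i=1}^k (x_iY+y_iX)\right)\left(1-\sum_{i=1}^k\frac{x_iy_i}{x_iY+y_iX}\right),$$ which is in fact a polynomial in these variables; its value at arbitrary real numbers (also where a denominator vanishes) means the value of this polynomial. If there are real numbers $x_1,\dots,x_k,y_1,\dots,y_k$ such that $\omega(v_iv_j)=x_iy_j+x_jy_i$ for all $1\le i<j\le k$, then $$\tau(K_k,\omega)=\phi(x_1,y_1,\dots,x_k,y_k).$$ -/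

import Mathlib

open scoped Classical in
/-- The weighted spanning-tree sum `τ(G, ω) = ∑_T ∏_{e ∈ E(T)} ω(e)`, where `T` runs over the
spanning trees of the finite graph `G` (the trees on the whole vertex set all of whose edges are
edges of `G`). Only the values of `ω` on edges of `G` enter the sum. -/
noncomputable def weightedTreeSum {V : Type*} [Fintype V] (G : SimpleGraph V)
    (ω : Sym2 V → ℝ) : ℝ :=
  ∑ T : SimpleGraph V with T ≤ G ∧ T.IsTree, ∏ e ∈ T.edgeFinset, ω e

/-- Polynomials with real coefficients in the `2k` variables `x_i` (left summand) and `y_i`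
(right summand). -/
abbrev XYPoly (k : ℕ) : Type := MvPolynomial (Fin k ⊕ Fin k) ℝ

/-- Rational functions in the `2k` variables `x_i`, `y_i`. -/
abbrev XYRat (k : ℕ) : Type := FractionRing (XYPoly k)

/-- The variable `x_i`. -/
noncomputable def xVar {k : ℕ} (i : Fin k) : XYPoly k := MvPolynomial.X (Sum.inl i)

/-- The variable `y_i`. -/
noncomputable def yVar {k : ℕ} (i : Fin k) : XYPoly k := MvPolynomial.X (Sum.inr i)

/-- The rational function
`(1 / (X Y)) * ∏ (x_i Y + y_i X) * (1 - ∑ x_i y_i / (x_i Y + y_i X))`,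
with `X = ∑ x_i` and `Y = ∑ y_i`. -/
noncomputable def phiRat (k : ℕ) : XYRat k :=
  let x : Fin k → XYRat k := fun i => algebraMap (XYPoly k) (XYRat k) (xVar i)
  let y : Fin k → XYRat k := fun i => algebraMap (XYPoly k) (XYRat k) (yVar i)
  let X : XYRat k := ∑ i, x i
  let Y : XYRat k := ∑ i, y i
  1 / (X * Y) * (∏ i, (x i * Y + y i * X)) * (1 - ∑ i, x i * y i / (x i * Y + y i * X))

theorem prod_eq_of_mul_eq_zero {R ι : Type*} [CommRing R] (a b : ι → R) (A B : R)
    (h : A * B = 0) (s : Finset ι) (hs : s.Nonempty) :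
    ∏ i ∈ s, (a i * B + b i * A)
      = B ^ s.card * ∏ i ∈ s, a i + A ^ s.card * ∏ i ∈ s, b i := by
  induction hs using Finset.Nonempty.cons_induction with
  | singleton i => simp; ring
  | cons i s hi hs ih =>
    have hc : s.card ≠ 0 := by simpa using hs.ne_empty
    obtain ⟨n, hn⟩ : ∃ n, s.card = n + 1 := Nat.exists_eq_succ_of_ne_zero hc
    rw [Finset.prod_cons, ih, Finset.prod_cons, Finset.prod_cons, Finset.card_cons, hn]
    linear_combination (a i * A ^ n * (∏ i ∈ s, b i) + b i * B ^ n * ∏ i ∈ s, a i) * h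

theorem numerator_eq_zero_of_mul_eq_zero {R : Type*} [CommRing R] {k : ℕ} (a b : Fin k → R)
    (h : (∑ i, a i) * (∑ i, b i) = 0) (hk : 1 ≤ k) :
    ∏ i, (a i * (∑ i, b i) + b i * ∑ i, a i)
      - ∑ i, a i * b i * ∏ j ∈ Finset.univ.erase i, (a j * (∑ i, b i) + b j * ∑ i, a i) = 0 := by
  obtain ⟨n, rfl⟩ : ∃ n, k = n + 1 := ⟨k - 1, by omega⟩
  rcases n with _ | n
  · simp at h ⊢
    linear_combination h
  · rw [prod_eq_of_mul_eq_zero a b _ _ h _ Finset.univ_nonempty]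
    have key : ∀ i : Fin (n + 1 + 1),
        a i * b i * ∏ j ∈ Finset.univ.erase i, (a j * (∑ i, b i) + b j * ∑ i, a i)
          = b i * ((∑ i, b i) ^ (n + 1) * ∏ j, a j) + a i * ((∑ i, a i) ^ (n + 1) * ∏ j, b j) := by
      intro i
      have hne : (Finset.univ.erase i).Nonempty := by
        rw [← Finset.card_pos, Finset.card_erase_of_mem (Finset.mem_univ _)]
        simp
      rw [prod_eq_of_mul_eq_zero a b _ _ h _ hne,
        ← Finset.mul_prod_erase Finset.univ a (Finset.mem_univ i),
        ← Finset.mul_prod_erase Finset.univ b (Finset.mem_univ i),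
        Finset.card_erase_of_mem (Finset.mem_univ _)]
      simp only [Finset.card_univ, Fintype.card_fin, Nat.add_sub_cancel]
      ring
    rw [Finset.sum_congr rfl fun i _ => key i, Finset.sum_add_distrib, ← Finset.sum_mul,
      ← Finset.sum_mul]
    simp only [Finset.card_univ, Fintype.card_fin]
    ring

theorem sum_xVar_ne_zero {k : ℕ} (hk : 1 ≤ k) : (∑ i : Fin k, xVar i) ≠ 0 := by
  intro h
  have := congrArg (MvPolynomial.eval (fun _ => (1 : ℝ))) h
  simp [xVar] at this
  omega

theorem sum_yVar_ne_zero {k : ℕ} (hk : 1 ≤ k) : (∑ i : Fin k, yVar i) ≠ 0 := by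
  intro h
  have := congrArg (MvPolynomial.eval (fun _ => (1 : ℝ))) h
  simp [yVar] at this
  omega

theorem denominator_ne_zero {k : ℕ} (i : Fin k) :
    xVar i * (∑ j, yVar j) + yVar i * (∑ j, xVar j) ≠ 0 := by
  intro h
  have := congrArg (MvPolynomial.eval (fun _ => (1 : ℝ))) h
  simp [xVar, yVar] at this
  have := i.2
  omega

/-- The rational function `phiRat k` is a polynomial. -/
theorem exists_algebraMap_eq_phiRat (k : ℕ) :
    ∃ P : XYPoly k, algebraMap (XYPoly k) (XYRat k) P = phiRat k := by
  rcases Nat.eq_zero_or_pos k with rfl | hk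
  · exact ⟨0, by simp [phiRat]⟩
  have hdvd : (∑ i : Fin k, xVar i) * (∑ i : Fin k, yVar i) ∣
      ∏ i : Fin k, (xVar i * (∑ i, yVar i) + yVar i * ∑ i, xVar i)
      - ∑ i : Fin k, xVar i * yVar i * ∏ j ∈ Finset.univ.erase i,
          (xVar j * (∑ i, yVar i) + yVar j * ∑ i, xVar i) := by
    rw [← Ideal.mem_span_singleton, ← Ideal.Quotient.eq_zero_iff_mem]
    set f := Ideal.Quotient.mk
      (Ideal.span {(∑ i : Fin k, xVar i) * (∑ i : Fin k, yVar i)}) with hf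
    have h0 : (∑ i : Fin k, f (xVar i)) * (∑ i : Fin k, f (yVar i)) = 0 := by
      rw [← map_sum, ← map_sum, ← map_mul, hf, Ideal.Quotient.eq_zero_iff_mem]
      exact Ideal.mem_span_singleton_self _
    have := numerator_eq_zero_of_mul_eq_zero _ _ h0 hk
    simpa only [map_sub, map_prod, map_add, map_mul, map_sum] using this
  obtain ⟨P, hP⟩ := hdvd
  refine ⟨P, ?_⟩
  have inj := IsFractionRing.injective (XYPoly k) (XYRat k)
  have hX := (map_ne_zero_iff _ inj).2 (sum_xVar_ne_zero hk)
  have hY := (map_ne_zero_iff _ inj).2 (sum_yVar_ne_zero hk)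
  have hW := fun i : Fin k => (map_ne_zero_iff _ inj).2 (denominator_ne_zero i)
  have hP' := congrArg (algebraMap (XYPoly k) (XYRat k)) hP
  simp only [map_sub, map_prod, map_add, map_mul, map_sum] at hP' hX hY hW
  simp only [phiRat]
  rw [one_div, mul_assoc, eq_inv_mul_iff_mul_eq₀ (mul_ne_zero hX hY), ← hP', mul_sub, mul_one,
    Finset.mul_sum]
  congr 1
  refine Finset.sum_congr rfl fun i _ => ?_
  rw [← Finset.mul_prod_erase Finset.univ _ (Finset.mem_univ i)]
  have aux : ∀ w p c : XYRat k, w ≠ 0 → c * p = w * p * (c / w) := by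
    intro w p c hw
    field_simp
  exact aux _ _ _ (hW i)

/-- The polynomial `φ` in `x_1, y_1, …, x_k, y_k`: the (unique) polynomial which, as a rational
function, is equal to `phiRat k`. -/
noncomputable def phiPoly (k : ℕ) : XYPoly k := (exists_algebraMap_eq_phiRat k).choose

theorem algebraMap_phiPoly (k : ℕ) :
    algebraMap (XYPoly k) (XYRat k) (phiPoly k) = phiRat k :=
  (exists_algebraMap_eq_phiRat k).choose_spec

/-- The value `φ(x_1, y_1, …, x_k, y_k)` of the polynomial `φ` at real numbers. -/
noncomputable def phi {k : ℕ} (x y : Fin k → ℝ) : ℝ :=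
  MvPolynomial.eval (Sum.elim x y) (phiPoly k)

/-!
Let `L` be the Laplacian of the weights `x i * y j + x j * y i`. As both the rows and the columns
of `L` sum to zero, adding a rank one matrix gives `det (L + u vᵀ) = (∑ u) (∑ v) τ`, where `τ` is
the common value of the principal minors of `L`, which is the weighted number of spanning trees by
the matrix-tree theorem. The weights are chosen so that
`L + x yᵀ = diag (x i * Y + y i * X) - y xᵀ`, and the determinant of a rank one perturbation of a
diagonal matrix is elementary; dividing by `X * Y` gives `φ`.

The matrix-tree theorem follows by expanding a principal minor multilinearly in its rows: the terms
are indexed by the maps sending each vertex `v ≠ r` to a "parent", and only those maps that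
describe a tree rooted at `r` contribute.
-/

open Finset Matrix

theorem exists_adj_dist_lt {V : Type*} {G : SimpleGraph V} (hG : G.Connected) {v r : V}
    (hv : v ≠ r) :
    ∃ w, G.Adj v w ∧ G.dist w r < G.dist v r := by
  obtain ⟨p, hp⟩ := hG.exists_walk_length_eq_dist v r
  cases p with
  | nil => exact absurd rfl hv
  | @cons _ w _ hvw q =>
    refine ⟨w, hvw, ?_⟩
    rw [← hp, SimpleGraph.Walk.length_cons]
    exact Nat.lt_succ_of_le (SimpleGraph.dist_le q)

theorem det_smul_eq_zero_of_mulVec_eq_zero {n R : Type*} [Fintype n] [DecidableEq n] [CommRing R]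
    {A : Matrix n n R} {v : n → R} (h : A *ᵥ v = 0) : A.det • v = 0 := by
  rw [← one_mulVec v, ← smul_mulVec, ← adjugate_mul, ← mulVec_mulVec, h, mulVec_zero]

/-- A choice of a parent for every vertex other than the root `r`. -/
abbrev ParentMap {V : Type*} (r : V) : Type _ := {v // v ≠ r} → V

namespace ParentMap

variable {V : Type*} {r : V} {f g : ParentMap r}

/-- The relation "`p` is the parent of `c`". -/
def IsParent (f : ParentMap r) (p c : V) : Prop := ∃ i : {v // v ≠ r}, i.1 = c ∧ f i = p

/-- The edge joining a vertex to its parent. -/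
def edge (f : ParentMap r) (i : {v // v ≠ r}) : Sym2 V := s(i.1, f i)

/-- The graph whose edges join the vertices to their parents. -/
def graph (f : ParentMap r) : SimpleGraph V := SimpleGraph.fromEdgeSet (Set.range f.edge)

/-- Passing from vertices to parents always terminates, necessarily at the root: the parent map
describes a tree rooted at `r`. -/
def IsArborescence (f : ParentMap r) : Prop := WellFounded f.IsParent

theorem isParent_apply (f : ParentMap r) (i : {v // v ≠ r}) : f.IsParent (f i) i := ⟨i, rfl, rfl⟩

theorem acc_root (f : ParentMap r) : Acc f.IsParent r :=
  ⟨_, by rintro _ ⟨i, hi, -⟩; exact absurd hi i.2⟩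

theorem acc_iff_acc_apply (f : ParentMap r) (i : {v // v ≠ r}) :
    Acc f.IsParent i ↔ Acc f.IsParent (f i) := by
  refine ⟨fun h => h.inv (f.isParent_apply i), fun h => ⟨_, ?_⟩⟩
  rintro _ ⟨j, hj, rfl⟩
  rwa [Subtype.ext hj]

namespace IsArborescence

theorem apply_ne (hf : f.IsArborescence) (i : {v // v ≠ r}) : f i ≠ i := fun h =>
  hf.irrefl.irrefl i.1 ⟨i, rfl, h⟩

theorem apply_ne_of_apply_eq (hf : f.IsArborescence) {i j : {v // v ≠ r}} (h : f i = j) :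
    f j ≠ i := fun h' => hf.asymmetric j i ⟨i, rfl, h⟩ ⟨j, rfl, h'⟩

theorem edgeSet_graph (hf : f.IsArborescence) : f.graph.edgeSet = Set.range f.edge := by
  rw [graph, SimpleGraph.edgeSet_fromEdgeSet, sdiff_eq_left, Set.disjoint_left]
  rintro _ ⟨i, rfl⟩ h
  exact hf.apply_ne i (Sym2.mk_isDiag_iff.1 h).symm

theorem adj_apply (hf : f.IsArborescence) (i : {v // v ≠ r}) : f.graph.Adj i (f i) := by
  rw [← SimpleGraph.mem_edgeSet, hf.edgeSet_graph]
  exact ⟨i, rfl⟩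

theorem edge_injective (hf : f.IsArborescence) : Function.Injective f.edge := by
  intro i j h
  rcases Sym2.eq_iff.1 h with ⟨h, -⟩ | ⟨hij, hji⟩
  · exact Subtype.ext h
  · exact absurd hij.symm (hf.apply_ne_of_apply_eq hji)

theorem connected_graph (hf : f.IsArborescence) : f.graph.Connected := by
  have reachable_root (v : V) : f.graph.Reachable v r := by
    induction v using hf.induction with
    | _ v ih =>
      by_cases hv : v = r
      · rw [hv]
      · exact (hf.adj_apply ⟨v, hv⟩).reachable.trans (ih _ (f.isParent_apply ⟨v, hv⟩))
  have : Nonempty V := ⟨r⟩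
  exact ⟨fun u v => (reachable_root u).trans (reachable_root v).symm⟩

theorem isTree_graph [Finite V] (hf : f.IsArborescence) : f.graph.IsTree := by
  classical
  refine SimpleGraph.isTree_iff_connected_and_card.2 ⟨hf.connected_graph, ?_⟩
  rw [hf.edgeSet_graph, Nat.card_range_of_injective hf.edge_injective,
    ← Finite.card_option, Nat.card_congr (Equiv.optionSubtypeNe r)]

theorem eq_of_graph_eq (hf : f.IsArborescence) (hg : g.IsArborescence) (h : f.graph = g.graph) :
    f = g := by
  suffices ∀ v, ∀ hv : v ≠ r, f ⟨v, hv⟩ = g ⟨v, hv⟩ from funext fun i => this i i.2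
  intro v
  induction v using hf.induction with
  | _ v ih =>
    intro hv
    obtain ⟨j, hj⟩ : f.edge ⟨v, hv⟩ ∈ Set.range g.edge := by
      rw [← hg.edgeSet_graph, ← h, hf.edgeSet_graph]
      exact ⟨_, rfl⟩
    rcases Sym2.eq_iff.1 hj with ⟨hjv, hgj⟩ | ⟨hjf, hgj⟩
    · rw [← hgj, Subtype.ext hjv]
    · have hfj : f j = g j := ih j (hjf ▸ f.isParent_apply ⟨v, hv⟩) j.2
      exact absurd (hfj.trans hgj) (hf.apply_ne_of_apply_eq hjf.symm)

end IsArborescence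

theorem exists_isArborescence_graph_eq {T : SimpleGraph V} (hT : T.IsTree) (r : V) :
    ∃ f : ParentMap r, f.IsArborescence ∧ f.graph = T := by
  choose f hadj hlt using fun i : {v // v ≠ r} => exists_adj_dist_lt hT.connected i.2
  have hf : IsArborescence f := (measure fun v => T.dist v r).wf.mono <| by
    rintro _ _ ⟨i, rfl, rfl⟩
    exact hlt i
  refine ⟨f, hf, (SimpleGraph.isTree_iff_minimal_connected.1 hT).eq_of_le hf.connected_graph ?_⟩
  rw [← SimpleGraph.edgeSet_subset_edgeSet, hf.edgeSet_graph]
  rintro _ ⟨i, rfl⟩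
  exact hadj i

section Incidence

variable [DecidableEq V] (R : Type*) [CommRing R]

/-- The oriented incidence matrix of the edges from vertices to their parents, without the column
of the root. -/
def incidence (f : ParentMap r) : Matrix {v // v ≠ r} {v // v ≠ r} R :=
  of fun i j => (Pi.single i.1 1 - Pi.single (f i) 1 : V → R) j

variable {R}

theorem incidence_apply (f : ParentMap r) (i j : {v // v ≠ r}) :
    f.incidence R i j = (if j = i then 1 else 0) - if j = f i then 1 else 0 := by
  simp [incidence, Pi.single_apply, Subtype.ext_iff]

theorem incidence_mulVec_apply [Fintype V] (f : ParentMap r) {c : V → R} (hc : c r = 0)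
    (i : {v // v ≠ r}) : (f.incidence R *ᵥ fun j => c j) i = c i - c (f i) := by
  calc (f.incidence R *ᵥ fun j => c j) i
      = (Pi.single i.1 1 - Pi.single (f i) 1 : V → R) ⬝ᵥ c := by
        simp [dotProduct, Fintype.sum_eq_add_sum_subtype_ne _ r, hc, mulVec, incidence]
    _ = c i - c (f i) := by simp only [sub_dotProduct, single_one_dotProduct]

theorem IsArborescence.eq_one_of_forall_incidence_ne_zero (hf : f.IsArborescence)
    {σ : Equiv.Perm {v // v ≠ r}} (hσ : ∀ i, f.incidence R (σ i) i ≠ 0) : σ = 1 := by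
  suffices ∀ v, ∀ hv : v ≠ r, σ ⟨v, hv⟩ = ⟨v, hv⟩ from Equiv.ext fun i => this i i.2
  intro v
  induction v using hf.induction with
  | _ v ih =>
    intro hv
    obtain ⟨i, hi⟩ := σ.surjective ⟨v, hv⟩
    by_cases hiv : i = ⟨v, hv⟩
    · rwa [hiv] at hi
    · have hif : i.1 = f ⟨v, hv⟩ := by
        by_contra hif
        exact hσ i (by simp [hi, incidence_apply, hiv, hif])
      have hfixed : σ i = i := ih i (hif ▸ f.isParent_apply ⟨v, hv⟩) i.2
      exact absurd (hfixed.symm.trans hi) hiv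

theorem IsArborescence.det_incidence [Fintype V] (hf : f.IsArborescence) :
    (f.incidence R).det = 1 := by
  rw [det_apply, sum_eq_single 1]
  · simp [incidence_apply, (hf.apply_ne _).symm]
  · intro σ _ hσ
    obtain ⟨i, hi⟩ : ∃ i, f.incidence R (σ i) i = 0 := by
      contrapose! hσ
      exact hf.eq_one_of_forall_incidence_ne_zero hσ
    exact smul_eq_zero_of_right _ (prod_eq_zero (mem_univ i) hi)
  · simp

theorem det_incidence_of_not_isArborescence [Fintype V] (hf : ¬ f.IsArborescence) :
    (f.incidence R).det = 0 := by
  classical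
  obtain ⟨v, hv⟩ : ∃ v, ¬ Acc f.IsParent v := by
    by_contra! h
    exact hf ⟨h⟩
  have hvr : v ≠ r := fun h => hv (h ▸ f.acc_root)
  -- The indicator of the vertices without a path to the root lies in the kernel.
  let c : V → R := fun u => if Acc f.IsParent u then 0 else 1
  have hker : f.incidence R *ᵥ (fun j => c j) = 0 := by
    ext i
    rw [f.incidence_mulVec_apply (c := c) (if_pos f.acc_root)]
    simp [c, f.acc_iff_acc_apply i]
  simpa [c, hv] using congrFun (det_smul_eq_zero_of_mulVec_eq_zero hker) ⟨v, hvr⟩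

end Incidence

end ParentMap

section MatrixTree

variable {V R S : Type*} [Fintype V] [CommRing R] [CommRing S]

open scoped Classical in
/-- The weighted spanning-tree sum of the complete graph on `V`, with weights in an arbitrary
commutative ring. -/
noncomputable def treeSum (ω : Sym2 V → R) : R :=
  ∑ T : SimpleGraph V with T.IsTree, ∏ e ∈ T.edgeFinset, ω e

theorem map_treeSum (φ : R →+* S) (ω : Sym2 V → R) :
    φ (treeSum ω) = treeSum fun e => φ (ω e) := by
  simp only [treeSum, map_sum, map_prod]

theorem treeSum_congr {ω ω' : Sym2 V → R} (h : ∀ i j, i ≠ j → ω s(i, j) = ω' s(i, j)) :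
    treeSum ω = treeSum ω' := by
  classical
  refine sum_congr rfl fun T _ => prod_congr rfl fun e he => ?_
  induction e with
  | _ i j => exact h i j (SimpleGraph.mem_edgeFinset.1 he).ne

theorem weightedTreeSum_top (ω : Sym2 V → ℝ) : weightedTreeSum ⊤ ω = treeSum ω :=
  sum_congr (by ext; simp) fun _ _ => rfl

open scoped Classical in
theorem treeSum_eq_sum_parentMap [DecidableEq V] (ω : Sym2 V → R) (r : V) :
    treeSum ω = ∑ f : ParentMap r with f.IsArborescence, ∏ i, ω (f.edge i) := by
  symm
  refine sum_bij (fun f _ => f.graph) ?_ ?_ ?_ ?_ <;> simp only [mem_filter_univ]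
  · exact fun f hf => hf.isTree_graph
  · exact fun f hf g hg h => hf.eq_of_graph_eq hg h
  · intro T hT
    obtain ⟨f, hf, h⟩ := ParentMap.exists_isArborescence_graph_eq hT r
    exact ⟨f, hf, h⟩
  · intro f hf
    have hedges : f.graph.edgeFinset = univ.image f.edge := by
      ext e
      simp [hf.edgeSet_graph]
    rw [hedges, prod_image hf.edge_injective.injOn]

variable [DecidableEq V]

/-- The Laplacian matrix of the complete graph with edge weights `ω`. The weights of the loops
cancel. -/
def weightedLapMatrix (ω : Sym2 V → R) : Matrix V V R :=
  diagonal (fun i => ∑ j, ω s(i, j)) - of fun i j => ω s(i, j)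

theorem weightedLapMatrix_row (ω : Sym2 V → R) (i : V) :
    weightedLapMatrix ω i = ∑ j, ω s(i, j) • (Pi.single i 1 - Pi.single j 1) := by
  ext k
  simp [weightedLapMatrix, diagonal_apply, Pi.single_apply, mul_sub, eq_comm]

theorem weightedLapMatrix_mulVec_one (ω : Sym2 V → R) : weightedLapMatrix ω *ᵥ 1 = 0 := by
  ext i
  change weightedLapMatrix ω i ⬝ᵥ 1 = 0
  simp only [weightedLapMatrix_row, sum_dotProduct, smul_dotProduct, sub_dotProduct,
    single_one_dotProduct, Pi.one_apply, sub_self, smul_zero, sum_const_zero]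

theorem isSymm_weightedLapMatrix (ω : Sym2 V → R) : (weightedLapMatrix ω).IsSymm := by
  rw [IsSymm, weightedLapMatrix, transpose_sub, diagonal_transpose]
  congr 1
  ext i j
  simp only [transpose_apply, of_apply, Sym2.eq_swap]

theorem one_vecMul_weightedLapMatrix (ω : Sym2 V → R) : 1 ᵥ* weightedLapMatrix ω = 0 := by
  rw [← (isSymm_weightedLapMatrix ω).eq, vecMul_transpose, weightedLapMatrix_mulVec_one]

/-- The weighted **matrix-tree theorem**. -/
theorem treeSum_eq_det_weightedLapMatrix (ω : Sym2 V → R) (r : V) :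
    treeSum ω = (toSquareBlockProp (weightedLapMatrix ω) (· ≠ r)).det := by
  classical
  have hrows : toSquareBlockProp (weightedLapMatrix ω) (· ≠ r) =
      fun i => ∑ j, ω s(i.1, j) •
        fun k : {v // v ≠ r} => (Pi.single i.1 1 - Pi.single j 1 : V → R) k := by
    ext i k
    simp only [toSquareBlockProp_def, of_apply, weightedLapMatrix_row, Finset.sum_apply,
      Pi.smul_apply]
  calc treeSum ω
      = ∑ f : ParentMap r with f.IsArborescence, ∏ i, ω (f.edge i) :=
        treeSum_eq_sum_parentMap ω r
    _ = ∑ f : ParentMap r, (∏ i, ω (f.edge i)) * (f.incidence R).det := by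
        rw [sum_filter]
        refine sum_congr rfl fun f _ => ?_
        split_ifs with hf
        · rw [hf.det_incidence, mul_one]
        · rw [f.det_incidence_of_not_isArborescence hf, mul_zero]
    _ = (toSquareBlockProp (weightedLapMatrix ω) (· ≠ r)).det := by
        rw [hrows]
        let D := (detRowAlternating (n := {v // v ≠ r}) (R := R)).toMultilinearMap
        exact (sum_congr rfl fun f _ => (D.map_smul_univ _ (f.incidence R)).symm).trans
          (D.map_sum _).symm

end MatrixTree

section RankOne

variable {n R K : Type*} [Fintype n] [DecidableEq n] [CommRing R] [Field K]

theorem det_add_vecMulVec_of_one_vecMul_eq_zero {A : Matrix n n R} (hA : 1 ᵥ* A = 0)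
    (u v : n → R) (r : n) : (A + vecMulVec u v).det = (∑ i, u i) * (A.updateRow r v).det := by
  set M := A + vecMulVec u v
  have hM : ∑ i, M i = (∑ i, u i) • v := by
    rw [← one_vecMul, vecMul_add, hA, zero_add, vecMul_vecMulVec, one_dotProduct]
  calc M.det
      = (M.updateRow r (∑ i, M i)).det := by simpa using (det_updateRow_sum M r 1).symm
    _ = (∑ i, u i) * (M.updateRow r v).det := by rw [hM, det_updateRow_smul]
    _ = (∑ i, u i) * (A.updateRow r v).det := by
        congr 1
        refine det_eq_of_forall_row_eq_smul_add_const (Function.update u r 0) r (by simp) ?_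
        intro i j
        by_cases hi : i = r
        · simp [hi]
        · simp [M, hi, vecMulVec_apply]

theorem det_updateRow_of_mulVec_one_eq_zero {A : Matrix n n R} (hA : A *ᵥ 1 = 0)
    (v : n → R) (r : n) :
    (A.updateRow r v).det = (∑ i, v i) * (toSquareBlockProp A (· ≠ r)).det := by
  set M := (A.updateRow r v).updateCol r (Pi.single r (∑ i, v i))
  have hsum : (fun i => ∑ j, A.updateRow r v i j) = Pi.single r (∑ i, v i) := by
    ext i
    by_cases hi : i = r
    · subst hi; simp
    · simpa [hi, mulVec, dotProduct] using congrFun hA i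
  have hcol : (A.updateRow r v).det = M.det := by
    simpa [hsum] using (det_updateCol_sum (A.updateRow r v) r 1).symm
  have hblock : toSquareBlockProp M (· ≠ r) = toSquareBlockProp A (· ≠ r) := by
    ext i j
    simp [toSquareBlockProp_def, M, i.2, j.2]
  have hcorner : (toSquareBlockProp M fun i => ¬ i ≠ r).det = ∑ i, v i := by
    have : Unique {i // ¬ i ≠ r} := ⟨⟨⟨r, by simp⟩⟩, fun i => Subtype.ext (not_not.1 i.2)⟩
    rw [det_unique, toSquareBlockProp_def, of_apply, not_not.1 (default : {i // ¬ i ≠ r}).2]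
    simp [M]
  have hzero (i : n) (hi : i ≠ r) (j : n) (hj : ¬ j ≠ r) : M i j = 0 := by
    simp [M, not_not.1 hj, hi]
  rw [hcol, twoBlockTriangular_det' M _ hzero, hblock, hcorner, mul_comm]

theorem det_add_vecMulVec_of_mulVec_one_of_one_vecMul {A : Matrix n n R} (hA : A *ᵥ 1 = 0)
    (hA' : 1 ᵥ* A = 0) (u v : n → R) (r : n) :
    (A + vecMulVec u v).det =
      (∑ i, u i) * (∑ i, v i) * (toSquareBlockProp A (· ≠ r)).det := by
  rw [det_add_vecMulVec_of_one_vecMul_eq_zero hA' u v r,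
    det_updateRow_of_mulVec_one_eq_zero hA v r, mul_assoc]

theorem det_diagonal_sub_vecMulVec {w : n → K} (hw : ∀ i, w i ≠ 0) (u v : n → K) :
    (diagonal w - vecMulVec u v).det = (∏ i, w i) * (1 - ∑ i, v i * u i / w i) := by
  have hfactor : diagonal w - vecMulVec u v =
      diagonal w * (1 + replicateCol Unit (-u / w) * replicateRow Unit v) := by
    rw [mul_add, mul_one, ← vecMulVec_eq, sub_eq_add_neg]
    congr 1
    ext i j
    rw [diagonal_mul, neg_apply, vecMulVec_apply, vecMulVec_apply, Pi.div_apply, Pi.neg_apply,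
      ← mul_assoc, mul_div_cancel₀ _ (hw i), neg_mul]
  rw [hfactor, det_mul, det_diagonal, det_one_add_replicateCol_mul_replicateRow]
  congr 1
  simp [dotProduct, neg_div, mul_div_assoc, sub_eq_add_neg]

end RankOne

section BilinearWeight

variable {V R S K : Type*} [CommRing R] [CommRing S] [Field K]

/-- The edge weights `ω(v_i v_j) = x_i y_j + x_j y_i` of the theorem. -/
def bilinearWeight (x y : V → R) : Sym2 V → R :=
  Sym2.lift ⟨fun i j => x i * y j + x j * y i, fun _ _ => add_comm _ _⟩

@[simp]
theorem bilinearWeight_mk (x y : V → R) (i j : V) :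
    bilinearWeight x y s(i, j) = x i * y j + x j * y i := rfl

theorem map_bilinearWeight (φ : R →+* S) (x y : V → R) (e : Sym2 V) :
    φ (bilinearWeight x y e) = bilinearWeight (fun i => φ (x i)) (fun i => φ (y i)) e := by
  induction e with
  | _ i j => simp

variable [Fintype V]

theorem weightedLapMatrix_bilinearWeight_add [DecidableEq V] (x y : V → R) :
    weightedLapMatrix (bilinearWeight x y) + vecMulVec x y =
      diagonal (fun i => x i * ∑ j, y j + y i * ∑ j, x j) - vecMulVec y x := by
  have hdeg (i : V) : ∑ j, (x i * y j + x j * y i) = x i * ∑ j, y j + y i * ∑ j, x j := by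
    rw [sum_add_distrib, mul_sum, mul_comm (y i), sum_mul]
  have hweight : of (fun i j => bilinearWeight x y s(i, j)) = vecMulVec x y + vecMulVec y x := by
    ext i j
    simp [vecMulVec_apply, mul_comm (y i)]
  rw [weightedLapMatrix, hweight]
  simp only [bilinearWeight_mk, hdeg]
  abel

theorem sum_mul_sum_mul_treeSum_bilinearWeight [Nonempty V] [DecidableEq V] (x y : V → R) :
    (∑ i, x i) * (∑ i, y i) * treeSum (bilinearWeight x y) =
      (diagonal (fun i => x i * ∑ j, y j + y i * ∑ j, x j) - vecMulVec y x).det := by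
  obtain ⟨r⟩ := ‹Nonempty V›
  rw [treeSum_eq_det_weightedLapMatrix _ r, ← weightedLapMatrix_bilinearWeight_add,
    det_add_vecMulVec_of_mulVec_one_of_one_vecMul (weightedLapMatrix_mulVec_one _)
      (one_vecMul_weightedLapMatrix _) x y r]

theorem treeSum_bilinearWeight {x y : V → K} (hX : ∑ i, x i ≠ 0) (hY : ∑ i, y i ≠ 0)
    (hw : ∀ i, x i * ∑ j, y j + y i * ∑ j, x j ≠ 0) :
    treeSum (bilinearWeight x y) =
      1 / ((∑ i, x i) * ∑ i, y i) * (∏ i, (x i * ∑ j, y j + y i * ∑ j, x j)) *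
        (1 - ∑ i, x i * y i / (x i * ∑ j, y j + y i * ∑ j, x j)) := by
  classical
  have : Nonempty V := (nonempty_of_sum_ne_zero hX).to_type
  rw [mul_assoc, ← det_diagonal_sub_vecMulVec hw, ← sum_mul_sum_mul_treeSum_bilinearWeight,
    one_div, inv_mul_cancel_left₀ (mul_ne_zero hX hY)]

end BilinearWeight

theorem phiPoly_eq_treeSum {k : ℕ} (hk : 1 ≤ k) :
    phiPoly k = treeSum (bilinearWeight xVar yVar) := by
  have hinj := IsFractionRing.injective (XYPoly k) (XYRat k)
  have hX := (map_ne_zero_iff _ hinj).2 (sum_xVar_ne_zero hk)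
  have hY := (map_ne_zero_iff _ hinj).2 (sum_yVar_ne_zero hk)
  have hw := fun i : Fin k => (map_ne_zero_iff _ hinj).2 (denominator_ne_zero i)
  simp only [map_sum, map_add, map_mul] at hX hY hw
  apply hinj
  simp only [algebraMap_phiPoly, map_treeSum, map_bilinearWeight]
  exact (treeSum_bilinearWeight hX hY hw).symm

theorem phi_eq_treeSum {k : ℕ} (hk : 1 ≤ k) (x y : Fin k → ℝ) :
    phi x y = treeSum (bilinearWeight x y) := by
  simp only [phi, phiPoly_eq_treeSum hk, map_treeSum, map_bilinearWeight, xVar, yVar,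
    MvPolynomial.eval_X, Sum.elim_inl, Sum.elim_inr]

theorem theorem4p2 (k : ℕ) (hk : 1 ≤ k) (ω : Sym2 (Fin k) → ℝ) (x y : Fin k → ℝ)
    (hω : ∀ i j : Fin k, i < j → ω s(i, j) = x i * y j + x j * y i) :
    weightedTreeSum (⊤ : SimpleGraph (Fin k)) ω = phi x y := by
  rw [weightedTreeSum_top, phi_eq_treeSum hk]
  refine treeSum_congr fun i j hij => ?_
  rcases hij.lt_or_gt with h | h
  · exact hω i j h
  · rw [Sym2.eq_swap, hω j i h, bilinearWeight_mk, add_comm]
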